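/- Let $\mathcal G$ be a (strict) 2-groupoid, i.e. a strict 2-category in which every 1-cell and every 2-cell is strictly invertible; let $X$ be its set of objects. Write composition of 1-cells additively in diagrammatic order and let $\alpha,\beta$ be source and target. Let $\mathcal C=(C,G,\delta)$ be the crossed module of groupoids corresponding to $\mathcal G$ under the usual equivalence: $G$ is the groupoid of 1-cells of $\mathcal G$; for $x\in X$, $C(x)$ is the group, under horizontal composition, of the 2-cells $c:1_x\Rightarrow\delta c$ with $\delta c:x\to x$; and $G$ acts on $C$ by $c^a=-a+c+a$ (whiskering). Let $\mathrm{Aut}(\mathcal G)$ be the group (under composition) of invertible strict 2-functors $\mathcal G\to\mathcal G$. Let $FDer(\mathcal G)$ be the monoid of free derivations on $\mathcal C$: pairs $s=(s_0,s_1)$ with $s_0(x)\in G$, $\beta s_0(x)=x$ for $x \in X$, $s_1(a)\in C(\beta a)$ for $a \in G$, and $s_1(a+b)=s_1(a)^b+s_1(b)$. Each $s$ defines an endomorphism $f=\Delta(s)$ of $\mathcal C$ by $$f_0(x)=\alpha s_0(x),\quad f_1(a)=s_0(\alpha a)+a+\delta s_1(a)-s_0(\beta a),\quad f_2(c)=(c+s_1\delta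 c)^{-s_0(\beta c)},$$ and the multiplication is, with $g=\Delta(t)$, $(s*t)_0(x)=s_0(g_0x)+t_0(x)$ and $(s*t)_1(a)=t_1(a)+s_1(g_1a)^{t_0(\beta a)}$. Let $FDer^*(\mathcal G)$ be its group of invertible elements, and let $M_2(\mathcal G)$ be the group of sections $l:X\to C$, $l(x)\in C(x)$, under pointwise addition. A 2-crossed module of groups $L\xrightarrow{\partial}M\xrightarrow{\partial}P$ consists of groups $L, M, P$, homomorphisms with $\partial\partial=1$, right actions (by automorphisms) of $P$ on $L$ and on $M$ for which both maps $\partial$ are $P$-equivariant ($P$ acting on itself by conjugation), a right action of $M$ on $L$ making $L\to M$ a crossed module and satisfying $(l^m)^p=(l^p)^{m^p}$, and a function (Peiffer lifting) $\langle\,,\rangle:M\times M\to L$ with $$\partial\langle m_0,m_1\rangle=m_0^{-1}m_1^{-1}m_0m_1^{\partial m_0},\quad \langle\partial l,m\rangle=l^{-1}l^m,\quad \langle m,\partial l\rangle=(l^{m})^{-1}l^{\partial m},$$ $$\langle m_0,m_1m_2\rangle=\langle m_0,m_2\rangle\langle m_0,m_1\rangle^{m_2^{\partial m_0}},\quad \langle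 m_0m_1,m_2\rangle=\langle m_0,m_2\rangle^{m_1}\langle m_1,m_2^{\partial m_0}\rangle,\quad \langle m_0,m_1\rangle^p=\langle m_0^p,m_1^p\rangle.$$ **Theorem.** The canonical homomorphism $\mathrm{Aut}(\mathcal G)\to\mathrm{Aut}(\mathcal C)$ is an isomorphism (write its components on an automorphism $f$ as $f_0,f_1,f_2$), and there is a unique 2-crossed module $$M_2(\mathcal G)\xrightarrow{\ \zeta\ }FDer^*(\mathcal G)\xrightarrow{\ \Delta\ }\mathrm{Aut}(\mathcal G)$$ in which $\zeta(l)=(\delta l,l_1)$ with $l_1(a)=-l(\alpha a)^a+l(\beta a)$; $\Delta(s)$ is the automorphism of $\mathcal G$ that corresponds to the automorphism $\Delta(s)$ of $\mathcal C$ defined above; $FDer^*(\mathcal G)$ acts on $M_2(\mathcal G)$ by $l^{t}(x)=l(\alpha t_0(x))^{t_0(x)}$; $\mathrm{Aut}(\mathcal G)$ acts by $l^f=f_2^{-1}\,l\,f_0$ and $s^f=(f_1^{-1}s_0f_0,\;f_2^{-1}s_1f_1)$; and the Peiffer lifting is $$\langle s,t\rangle(x)=\bigl((s^{-1})_1(t_0(f_0(x)))\bigr)^{s_0(x)},\qquad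 f=\Delta(s).$$ -/

import Mathlib

open CategoryTheory

set_option linter.unusedSectionVars false
set_option linter.unusedSimpArgs false

universe w w' v v' u u'

namespace Holonomy

/-- A crossed module of groupoids `(C, G, δ)`, where `G` is a groupoid with object type `X`.  The
totally intransitive groupoid `C` over `X` is the family of its vertex groups `C x`, written
multiplicatively; the groupoid composition `a + b` is `a ≫ b`. -/
structure XMod (X : Type u) [Category.{v} X] [IsGroupoid X] where
  C : X → Type w
  [group : ∀ x, Group (C x)]
  δ : ∀ {x : X}, C x → (x ⟶ x)
  δ_mul : ∀ {x : X} (c d : C x), δ (c * d) = δ c ≫ δ d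
  act : ∀ {x y : X}, C x → (x ⟶ y) → C y
  mul_act : ∀ {x y : X} (c d : C x) (a : x ⟶ y), act (c * d) a = act c a * act d a
  act_comp : ∀ {x y z : X} (c : C x) (a : x ⟶ y) (b : y ⟶ z), act c (a ≫ b) = act (act c a) b
  act_id : ∀ {x : X} (c : C x), act c (𝟙 x) = c
  δ_act : ∀ {x y : X} (c : C x) (a : x ⟶ y), δ (act c a) = inv a ≫ δ c ≫ a
  act_δ : ∀ {x : X} (c d : C x), act c (δ d) = d⁻¹ * c * d

attribute [instance] XMod.group

namespace XMod

section
variable {X : Type u} [Category.{v} X] [IsGroupoid X]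
variable {Y : Type u'} [Category.{v'} Y] [IsGroupoid Y]

/-- Morphisms of crossed modules of groupoids: a functor `(f₀, f₁)` together with a family `f₂` of
group homomorphisms, compatible with `δ` and with the actions. -/
structure Hom (𝒞 : XMod.{w} X) (𝒟 : XMod.{w'} Y) where
  base : X ⥤ Y
  top : ∀ x : X, 𝒞.C x →* 𝒟.C (base.obj x)
  δ_top : ∀ {x : X} (c : 𝒞.C x), 𝒟.δ (top x c) = base.map (𝒞.δ c)
  top_act : ∀ {x y : X} (c : 𝒞.C x) (a : x ⟶ y),
    top y (𝒞.act c a) = 𝒟.act (top x c) (base.map a)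

theorem Hom.ext_of {𝒞 : XMod.{w} X} {𝒟 : XMod.{w'} Y} {base : X ⥤ Y}
    {t t' : ∀ x : X, 𝒞.C x →* 𝒟.C (base.obj x)} {h₁ h₁' h₂ h₂'}
    (h : ∀ (x : X) (c : 𝒞.C x), t x c = t' x c) :
    (⟨base, t, h₁, h₂⟩ : Hom 𝒞 𝒟) = ⟨base, t', h₁', h₂'⟩ := by
  obtain rfl : t = t' := funext fun x => MonoidHom.ext (h x)
  rfl

variable (𝒞 : XMod.{w} X)

/-- The monoid `End(𝒞)` of endomorphisms of a crossed module; `f * g` is `f ∘ g`. -/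
instance Hom.instMonoid : Monoid (Hom 𝒞 𝒞) where
  one :=
    { base := 𝟭 X
      top := fun _ => MonoidHom.id _
      δ_top := fun _ => rfl
      top_act := fun _ _ => rfl }
  mul f g :=
    { base := g.base ⋙ f.base
      top := fun x => (f.top (g.base.obj x)).comp (g.top x)
      δ_top := fun c => by simp [f.δ_top, g.δ_top]
      top_act := fun c a => by simp [f.top_act, g.top_act] }
  mul_assoc _ _ _ := rfl
  one_mul _ := rfl
  mul_one _ := rfl

/-- The group `Aut(𝒞)` of automorphisms of a crossed module. -/
abbrev Aut : Type _ := (Hom 𝒞 𝒞)ˣ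

/-- Free derivations on `𝒞`, that is, homotopies `(s, 1)` on the identity morphism of `𝒞`:
`s₀ x` is an arrow with target `x` (and source `src x`), and `s₁` is a derivation. -/
structure FDer where
  src : X → X
  s₀ : ∀ x : X, src x ⟶ x
  s₁ : ∀ {x y : X}, (x ⟶ y) → 𝒞.C y
  s₁_comp : ∀ {x y z : X} (a : x ⟶ y) (b : y ⟶ z), s₁ (a ≫ b) = 𝒞.act (s₁ a) b * s₁ b

variable {𝒞}

theorem δ_one (x : X) : 𝒞.δ (1 : 𝒞.C x) = 𝟙 x := by
  have h := 𝒞.δ_mul (1 : 𝒞.C x) 1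
  rw [mul_one] at h
  rw [← cancel_epi (𝒞.δ (1 : 𝒞.C x)), ← h, Category.comp_id]

theorem one_act {x y : X} (a : x ⟶ y) : 𝒞.act (1 : 𝒞.C x) a = 1 := by
  have h := 𝒞.mul_act (1 : 𝒞.C x) 1 a
  rw [mul_one] at h
  exact left_eq_mul.mp h

theorem inv_act {x y : X} (c : 𝒞.C x) (a : x ⟶ y) : 𝒞.act c⁻¹ a = (𝒞.act c a)⁻¹ := by
  apply eq_inv_of_mul_eq_one_left
  rw [← 𝒞.mul_act, inv_mul_cancel, one_act]

/-- The arrow part `f₁ a = s₀ (α a) + a + δ (s₁ a) - s₀ (β a)` of `f = Δ(s)`. -/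
noncomputable def FDer.map (s : FDer 𝒞) {x y : X} (a : x ⟶ y) : s.src x ⟶ s.src y :=
  s.s₀ x ≫ a ≫ 𝒞.δ (s.s₁ a) ≫ inv (s.s₀ y)

theorem FDer.s₁_id (s : FDer 𝒞) (x : X) : s.s₁ (𝟙 x) = 1 := by
  have h := s.s₁_comp (𝟙 x) (𝟙 x)
  rw [Category.comp_id, 𝒞.act_id] at h
  exact left_eq_mul.mp h

theorem FDer.map_id (s : FDer 𝒞) (x : X) : s.map (𝟙 x) = 𝟙 (s.src x) := by
  simp [FDer.map, s.s₁_id, δ_one]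

theorem FDer.map_comp (s : FDer 𝒞) {x y z : X} (a : x ⟶ y) (b : y ⟶ z) :
    s.map (a ≫ b) = s.map a ≫ s.map b := by
  simp [FDer.map, s.s₁_comp, 𝒞.δ_mul, 𝒞.δ_act]

/-- The endomorphism `f = Δ(s)` with `s : f ≃ 1`:
`f₀ x = α (s₀ x)`, `f₁ a = s₀ (α a) + a + δ (s₁ a) - s₀ (β a)` and
`f₂ c = (c + s₁ (δ c)) ^ (- s₀ (β c))`. -/
noncomputable def Δ (s : FDer 𝒞) : Hom 𝒞 𝒞 where
  base :=
    { obj := s.src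
      map := s.map
      map_id := s.map_id
      map_comp := s.map_comp }
  top x :=
    MonoidHom.mk' (fun c => 𝒞.act (c * s.s₁ (𝒞.δ c)) (inv (s.s₀ x))) fun c d => by
      rw [← 𝒞.mul_act, 𝒞.δ_mul, s.s₁_comp, 𝒞.act_δ]
      congr 1
      group
  δ_top {x} c := by simp [FDer.map, 𝒞.δ_act, 𝒞.δ_mul]
  top_act {x y} c a := by
    have key : s.s₁ (𝒞.δ (𝒞.act c a)) =
        (𝒞.act c a)⁻¹ * (s.s₁ a)⁻¹ * 𝒞.act (c * s.s₁ (𝒞.δ c)) a * s.s₁ a := by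
      have h1 : a ≫ 𝒞.δ (𝒞.act c a) = 𝒞.δ c ≫ a := by simp [𝒞.δ_act]
      have h2 := congrArg s.s₁ h1
      rw [s.s₁_comp, s.s₁_comp, 𝒞.act_δ] at h2
      rw [𝒞.mul_act, mul_assoc, mul_assoc _ _ (s.s₁ a), ← mul_assoc _ _ (s.s₁ a)]
      simp only [mul_assoc] at h2 ⊢
      rw [← h2]
      group
    change 𝒞.act (𝒞.act c a * s.s₁ (𝒞.δ (𝒞.act c a))) (inv (s.s₀ y)) =
      𝒞.act (𝒞.act (c * s.s₁ (𝒞.δ c)) (inv (s.s₀ x)))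
        (s.s₀ x ≫ a ≫ 𝒞.δ (s.s₁ a) ≫ inv (s.s₀ y))
    rw [key, ← 𝒞.act_comp, IsIso.inv_hom_id_assoc, 𝒞.act_comp, 𝒞.act_comp, 𝒞.act_δ]
    congr 1
    group

/-- The multiplication of free derivations: with `g = Δ(t)`,
`(s * t)₀ x = s₀ (g₀ x) + t₀ x` and `(s * t)₁ a = t₁ a + (s₁ (g₁ a)) ^ (t₀ (β a))`. -/
noncomputable def FDer.mul (s t : FDer 𝒞) : FDer 𝒞 where
  src x := s.src (t.src x)
  s₀ x := s.s₀ (t.src x) ≫ t.s₀ x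
  s₁ {_ y} a := t.s₁ a * 𝒞.act (s.s₁ (t.map a)) (t.s₀ y)
  s₁_comp {x y z} a b := by
    have h : t.map b ≫ t.s₀ z = t.s₀ y ≫ b ≫ 𝒞.δ (t.s₁ b) := by simp [FDer.map]
    rw [t.map_comp, s.s₁_comp, t.s₁_comp, 𝒞.mul_act, 𝒞.mul_act, ← 𝒞.act_comp, h]
    simp only [𝒞.act_comp, 𝒞.act_δ]
    group

theorem FDer.mul_map (s t : FDer 𝒞) {x y : X} (a : x ⟶ y) :
    (s.mul t).map a = s.map (t.map a) := by
  simp only [FDer.map, FDer.mul, 𝒞.δ_mul, 𝒞.δ_act]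
  simp

/-- The trivial free derivation. -/
def FDer.one : FDer 𝒞 where
  src x := x
  s₀ x := 𝟙 x
  s₁ _ := 1
  s₁_comp a b := by rw [one_act, mul_one]

theorem FDer.one_map {x y : X} (a : x ⟶ y) : (FDer.one : FDer 𝒞).map a = a := by
  simp [FDer.map, FDer.one, δ_one]

theorem FDer.ext_of {src : X → X} {s₀ s₀' : ∀ x, src x ⟶ x}
    {s₁ s₁' : ∀ {x y : X}, (x ⟶ y) → 𝒞.C y} {h h'}
    (h₀ : ∀ x, s₀ x = s₀' x) (h₁ : ∀ {x y : X} (a : x ⟶ y), s₁ a = s₁' a) :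
    (⟨src, s₀, s₁, h⟩ : FDer 𝒞) = ⟨src, s₀', s₁', h'⟩ := by
  obtain rfl : s₀ = s₀' := funext h₀
  obtain rfl : @s₁ = @s₁' := by
    funext x y a
    exact h₁ a
  rfl

/-- The monoid `FDer(𝒞)` of free derivations. -/
noncomputable instance FDer.instMonoid : Monoid (FDer 𝒞) where
  one := FDer.one
  mul := FDer.mul
  mul_assoc r s t := by
    refine FDer.ext_of (fun x => Category.assoc _ _ _) (fun a => ?_)
    have h : 𝒞.act (r.s₁ (s.map (t.map a))) (s.s₀ (t.src _) ≫ t.s₀ _) =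
        𝒞.act (r.s₁ ((s.mul t).map a)) ((s.mul t).s₀ _) :=
      congrArg (fun b : s.src (t.src _) ⟶ s.src (t.src _) =>
        𝒞.act (r.s₁ b) (s.s₀ (t.src _) ≫ t.s₀ _)) (s.mul_map t a).symm
    change t.s₁ a * 𝒞.act (s.s₁ (t.map a) * 𝒞.act (r.s₁ (s.map (t.map a))) _) _ =
      t.s₁ a * 𝒞.act (s.s₁ (t.map a)) _ * 𝒞.act (r.s₁ ((s.mul t).map a)) _
    refine Eq.trans ?_ (congrArg _ h)
    rw [𝒞.mul_act, 𝒞.act_comp, mul_assoc]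
  one_mul s := by
    refine FDer.ext_of (fun x => Category.id_comp _) (fun a => ?_)
    change s.s₁ a * 𝒞.act 1 _ = s.s₁ a
    rw [one_act, mul_one]
  mul_one s := by
    refine FDer.ext_of (fun x => Category.comp_id _) (fun a => ?_)
    change 1 * 𝒞.act (s.s₁ ((FDer.one : FDer 𝒞).map a)) (𝟙 _) = s.s₁ a
    rw [FDer.one_map, 𝒞.act_id, one_mul]
    rfl

variable (𝒞) in
/-- The group `FDer*(𝒞)` of invertible free derivations (coadmissible homotopies). -/
abbrev FDerStar : Type _ := (FDer 𝒞)ˣ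

variable (𝒞) in
/-- The group `M₂(𝒞)` of sections of `β : C → X` under pointwise multiplication. -/
abbrev M₂ : Type _ := ∀ x : X, 𝒞.C x

/-- `ζ(l) = (δ l, l₁)` with `l₁ a = - l (α a) ^ a + l (β a)`. -/
def ζ (l : M₂ 𝒞) : FDer 𝒞 where
  src x := x
  s₀ x := 𝒞.δ (l x)
  s₁ {x y} a := (𝒞.act (l x) a)⁻¹ * l y
  s₁_comp {x y z} a b := by
    rw [𝒞.act_comp, 𝒞.mul_act, inv_act]
    group

end
end XMod
end Holonomy

namespace Holonomy

open Bicategory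

/-- A 2-cell `cell : 𝟙 x ⟶ arr` of a 2-category whose source is an identity 1-cell. -/
structure Loop {B : Type u} [Bicategory.{w, v} B] (x : B) where
  arr : x ⟶ x
  cell : 𝟙 x ⟶ arr

namespace Loop

section
variable {B : Type u} [Bicategory.{w, v} B]

theorem mk_eq {x : B} {a b : x ⟶ x} {η : 𝟙 x ⟶ a} {θ : 𝟙 x ⟶ b} (h : a = b)
    (h' : η ≫ eqToHom h = θ) : (⟨a, η⟩ : Loop x) = ⟨b, θ⟩ := by
  subst h
  simp at h'
  rw [h']

/-- The horizontal composite of two such 2-cells. -/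
def mul {x : B} (l m : Loop x) : Loop x where
  arr := l.arr ≫ m.arr
  cell := l.cell ≫ (ρ_ l.arr).inv ≫ l.arr ◁ m.cell

/-- The identity 2-cell on the identity 1-cell. -/
def one (x : B) : Loop x := ⟨𝟙 x, 𝟙 (𝟙 x)⟩

variable [Bicategory.Strict B]

theorem mul_assoc' {x : B} (l m n : Loop x) : mul (mul l m) n = mul l (mul m n) := by
  refine mk_eq (Strict.assoc l.arr m.arr n.arr) ?_
  dsimp only [mul]
  simp [Strict.rightUnitor_eqToIso, Strict.associator_eqToIso]

theorem one_mul' {x : B} (l : Loop x) : mul (one x) l = l := by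
  refine mk_eq (Strict.id_comp l.arr) ?_
  dsimp only [one]
  simp [Strict.leftUnitor_eqToIso, Strict.rightUnitor_eqToIso]

theorem mul_one' {x : B} (l : Loop x) : mul l (one x) = l := by
  refine mk_eq (Strict.comp_id l.arr) ?_
  dsimp only [one]
  simp [Strict.leftUnitor_eqToIso, Strict.rightUnitor_eqToIso]

variable [IsGroupoid B]

/-- Conjugation `c ^ a = - a + c + a` of such a 2-cell by a 1-cell, by whiskering on both sides. -/
noncomputable def conj {x y : B} (l : Loop x) (a : x ⟶ y) : Loop y where
  arr := inv a ≫ l.arr ≫ a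
  cell := eqToHom (by simp) ≫ inv a ◁ l.cell ▷ a

variable [IsLocallyGroupoid B]

/-- The inverse for horizontal composition. -/
noncomputable def inverse {x : B} (l : Loop x) : Loop x where
  arr := inv l.arr
  cell := eqToHom (IsIso.inv_hom_id l.arr).symm ≫ inv l.arr ◁ inv l.cell ≫ (ρ_ (inv l.arr)).hom

theorem inverse_mul {x : B} (l : Loop x) : mul (inverse l) l = one x := by
  refine mk_eq (IsIso.inv_hom_id l.arr) ?_
  dsimp only [inverse]
  simp [← whiskerLeft_comp_assoc]

noncomputable instance instGroup (x : B) : Group (Loop x) where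
  mul := mul
  one := one x
  inv := inverse
  mul_assoc := mul_assoc'
  one_mul := one_mul'
  mul_one := mul_one'
  inv_mul_cancel := inverse_mul

theorem whiskerLeft_cancel {x y z : B} (a : x ⟶ y) {f g : x ⟶ z} (η : f ⟶ g) :
    a ◁ inv a ◁ η = eqToHom (by simp) ≫ η ≫ eqToHom (by simp) := by
  have h : a ◁ inv a ◁ η = (α_ _ _ _).inv ≫ (a ≫ inv a) ◁ η ≫ (α_ _ _ _).hom := by
    simp only [comp_whiskerLeft, Category.assoc, Iso.inv_hom_id, Iso.inv_hom_id_assoc,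
      Category.comp_id]
  rw [h, congr_whiskerLeft (IsIso.hom_inv_id a)]
  simp only [id_whiskerLeft, Strict.leftUnitor_eqToIso, Strict.associator_eqToIso, eqToIso.hom,
    eqToIso.inv, Category.assoc, eqToHom_trans, eqToHom_trans_assoc]

theorem mul_conj {x y : B} (c d : Loop x) (a : x ⟶ y) :
    (mul c d).conj a = mul (c.conj a) (d.conj a) := by
  obtain ⟨c, η⟩ := c
  obtain ⟨d, θ⟩ := d
  dsimp only [mul, conj]
  refine mk_eq (by simp) ?_
  simp only [comp_whiskerLeft, whiskerLeft_comp, comp_whiskerRight, whisker_assoc,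
    whiskerLeft_cancel, Strict.rightUnitor_eqToIso, Strict.associator_eqToIso, eqToIso.hom,
    eqToIso.inv, Category.assoc, eqToHom_trans, eqToHom_trans_assoc, whiskerLeft_eqToHom,
    eqToHom_whiskerRight]

theorem exchange {x : B} {c d : x ⟶ x} (η : 𝟙 x ⟶ c) (θ : 𝟙 x ⟶ d) :
    η ≫ (ρ_ c).inv ≫ c ◁ θ = θ ≫ (λ_ d).inv ≫ η ▷ d := by
  have h := whisker_exchange η θ
  rw [id_whiskerLeft, whiskerRight_id, Category.assoc, Category.assoc, Category.assoc,
    Category.assoc, unitors_equal, cancel_epi] at h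
  exact h.symm

theorem conj_comp {x y z : B} (c : Loop x) (a : x ⟶ y) (b : y ⟶ z) :
    c.conj (a ≫ b) = (c.conj a).conj b := by
  obtain ⟨c, η⟩ := c
  dsimp only [conj]
  refine mk_eq (by simp) ?_
  simp [Strict.leftUnitor_eqToIso, Strict.rightUnitor_eqToIso, Strict.associator_eqToIso]
  rw [congr_whiskerLeft (IsIso.inv_comp)]
  simp [Strict.leftUnitor_eqToIso, Strict.rightUnitor_eqToIso, Strict.associator_eqToIso]

theorem conj_id {x : B} (c : Loop x) : c.conj (𝟙 x) = c := by
  obtain ⟨c, η⟩ := c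
  dsimp only [conj]
  refine mk_eq (by simp) ?_
  rw [congr_whiskerLeft (IsIso.inv_id)]
  simp [Strict.leftUnitor_eqToIso, Strict.rightUnitor_eqToIso]

theorem conj_arr {x : B} (c d : Loop x) : c.conj d.arr = mul (mul (inverse d) c) d := by
  obtain ⟨c, η⟩ := c
  obtain ⟨d, θ⟩ := d
  rw [mul_assoc']
  dsimp only [mul, conj, inverse]
  refine mk_eq rfl ?_
  have h := congrArg (fun z => inv d ◁ (inv θ ≫ z)) (exchange η θ)
  simp only [IsIso.inv_hom_id_assoc] at h
  simp only [Category.assoc, Iso.hom_inv_id_assoc, ← whiskerLeft_comp, h]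
  simp [Strict.leftUnitor_eqToIso]

end
end Loop

section
variable (B : Type u) [Bicategory.{w, v} B] [Bicategory.Strict B] [IsGroupoid B]
  [IsLocallyGroupoid B]

/-- The crossed module of groupoids associated with a 2-groupoid: its groupoid of 1-cells, together
with, at each object `x`, the group of 2-cells `c : 𝟙 x ⟶ δ c`. -/
noncomputable def XMod.ofTwoGroupoid : XMod.{max v w} B where
  C := Loop
  δ l := l.arr
  δ_mul _ _ := rfl
  act := Loop.conj
  mul_act := Loop.mul_conj
  act_comp := Loop.conj_comp
  act_id := Loop.conj_id
  δ_act _ _ := rfl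
  act_δ := Loop.conj_arr

end
end Holonomy

namespace Holonomy

open Bicategory

section
variable {B : Type u} [Bicategory.{w, v} B] [Bicategory.Strict B]

/-- The effect of a strict 2-functor on the 2-cells with source an identity 1-cell. -/
def Loop.map (F : StrictPseudofunctor B B) {x : B} (l : Loop x) : Loop (F.obj x) where
  arr := F.map l.arr
  cell := eqToHom (F.map_id x).symm ≫ F.map₂ l.cell

theorem Loop.map_id {x : B} (l : Loop x) : l.map (StrictPseudofunctor.id B) = l := by
  refine Loop.mk_eq (Eq.refl l.arr) ?_
  change (𝟙 (𝟙 x) ≫ l.cell) ≫ 𝟙 l.arr = l.cell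
  rw [Category.id_comp, Category.comp_id]

theorem Loop.map_comp (F G : StrictPseudofunctor B B) {x : B} (l : Loop x) :
    l.map (F.comp G) = (l.map F).map G := by
  obtain ⟨c, η⟩ := l
  refine Loop.mk_eq (Eq.refl (G.map (F.map c))) ?_
  have h : 𝟙 (G.obj (F.obj x)) = G.map (F.map (𝟙 x)) := by rw [F.map_id, G.map_id]
  change (eqToHom h ≫ G.map₂ (F.map₂ η)) ≫ 𝟙 (G.map (F.map c)) =
    eqToHom (G.map_id (F.obj x)).symm ≫ G.map₂ (eqToHom (F.map_id x).symm ≫ F.map₂ η)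
  rw [Category.comp_id, PrelaxFunctor.map₂_comp, PrelaxFunctor.map₂_eqToHom, eqToHom_trans_assoc]

theorem Loop.map_mul (F : StrictPseudofunctor B B) {x : B} (l m : Loop x) :
    (Loop.mul l m).map F = Loop.mul (l.map F) (m.map F) := by
  obtain ⟨c, η⟩ := l
  obtain ⟨d, θ⟩ := m
  dsimp only [mul, map]
  refine mk_eq (F.map_comp c d) ?_
  simp only [PrelaxFunctor.map₂_comp, Pseudofunctor.map₂_whisker_left, F.mapComp_eq_eqToIso,
    Strict.rightUnitor_eqToIso, eqToIso.hom, eqToIso.inv, PrelaxFunctor.map₂_eqToHom,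
    Category.assoc, whiskerLeft_comp, whiskerLeft_eqToHom, eqToHom_trans, eqToHom_trans_assoc,
    eqToHom_refl, Category.comp_id]

theorem Loop.map_conj [IsGroupoid B] (F : StrictPseudofunctor B B) {x y : B} (l : Loop x)
    (a : x ⟶ y) : (l.conj a).map F = (l.map F).conj (F.map a) := by
  obtain ⟨c, η⟩ := l
  have hinv : F.map (inv a) = inv (F.map a) := F.toFunctor.map_inv a
  dsimp only [conj, map]
  refine mk_eq (by rw [F.map_comp, F.map_comp, hinv]) ?_
  rw [congr_whiskerLeft hinv.symm]
  simp only [PrelaxFunctor.map₂_comp, Pseudofunctor.map₂_whisker_left,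
    Pseudofunctor.map₂_whisker_right, F.mapComp_eq_eqToIso,
    eqToIso.hom, eqToIso.inv, PrelaxFunctor.map₂_eqToHom, comp_whiskerRight,
    eqToHom_whiskerRight,
    Category.assoc, whiskerLeft_comp, whiskerLeft_eqToHom, eqToHom_trans, eqToHom_trans_assoc]

end

section
variable (B : Type u) [Bicategory.{w, v} B] [Bicategory.Strict B]

theorem strictPseudofunctor_ext {F G : StrictPseudofunctor B B}
    (h : F.toPrelaxFunctor = G.toPrelaxFunctor) : F = G := by
  obtain ⟨⟨⟨F, i, c, _, _, _, _, _⟩, hi, hi'⟩, hc, hc'⟩ := F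
  obtain ⟨⟨⟨G, j, d, _, _, _, _, _⟩, hj, hj'⟩, hd, hd'⟩ := G
  dsimp only at h
  subst h
  obtain rfl : i = j := by
    funext a
    exact (hi' a).trans (hj' a).symm
  obtain rfl : @c = @d := by
    funext x y z f g
    exact (hc' f g).trans (hd' f g).symm
  rfl

/-- The monoid of strict 2-functors from a 2-category to itself; `F * G` is `F ∘ G`. -/
instance instMonoidStrictPseudofunctor : Monoid (StrictPseudofunctor B B) where
  one := StrictPseudofunctor.id B
  mul F G := G.comp F
  mul_assoc _ _ _ := strictPseudofunctor_ext B rfl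
  one_mul _ := strictPseudofunctor_ext B rfl
  mul_one _ := strictPseudofunctor_ext B rfl

/-- The group `Aut(𝒢)` of automorphisms of a 2-groupoid, i.e. of invertible strict 2-functors. -/
abbrev TwoAut : Type _ := (StrictPseudofunctor B B)ˣ

variable [IsGroupoid B] [IsLocallyGroupoid B]

/-- The endomorphism of the associated crossed module induced by a strict 2-functor. -/
noncomputable def XMod.mapTwoGroupoid (F : StrictPseudofunctor B B) :
    XMod.Hom (XMod.ofTwoGroupoid B) (XMod.ofTwoGroupoid B) where
  base := F.toFunctor
  top _ := MonoidHom.mk' (Loop.map F) (Loop.map_mul F)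
  δ_top _ := rfl
  top_act := Loop.map_conj F

/-- The homomorphism `Aut(𝒢) → Aut(𝒞)` from the automorphisms of a 2-groupoid to those of its
associated crossed module. -/
noncomputable def XMod.autTwoGroupoid : TwoAut B →* XMod.Aut (XMod.ofTwoGroupoid B) :=
  Units.map
    { toFun := XMod.mapTwoGroupoid B
      map_one' := XMod.Hom.ext_of fun _ c => Loop.map_id c
      map_mul' := fun F G => XMod.Hom.ext_of fun _ c => Loop.map_comp G F c }

end

/-- A right action of a group `P` on a group `L` by automorphisms, `(l, p) ↦ l ^ p`. -/
structure RightAction (P : Type u) (L : Type v) [Group P] [Group L] where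
  act : L → P → L
  act_one : ∀ l, act l 1 = l
  act_mul : ∀ l p q, act l (p * q) = act (act l p) q
  mul_act : ∀ l l' p, act (l * l') p = act l p * act l' p

/-- 2-crossed modules of groups `L → M → P` (in Conduché's sense): a complex of `P`-groups
and `P`-equivariant homomorphisms, with an action of `M` on `L` for which `∂₂ : L → M` is a crossed
module, and a Peiffer lifting `M × M → L`. -/
structure TwoCrossedModule (L : Type u) (M : Type v) (P : Type w) [Group L] [Group M]
    [Group P] where
  d₂ : L →* M
  d₁ : M →* P
  actL : RightAction P L
  actM : RightAction P M
  actML : RightAction M L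
  d₁_d₂ : ∀ l, d₁ (d₂ l) = 1
  d₂_act : ∀ l p, d₂ (actL.act l p) = actM.act (d₂ l) p
  d₁_act : ∀ m p, d₁ (actM.act m p) = p⁻¹ * d₁ m * p
  d₂_actML : ∀ l m, d₂ (actML.act l m) = m⁻¹ * d₂ l * m
  actML_d₂ : ∀ l l', actML.act l (d₂ l') = l'⁻¹ * l * l'
  act_compat : ∀ l m p, actL.act (actML.act l m) p = actML.act (actL.act l p) (actM.act m p)
  lift : M → M → L
  lift₁ : ∀ m₀ m₁, d₂ (lift m₀ m₁) = m₀⁻¹ * m₁⁻¹ * m₀ * actM.act m₁ (d₁ m₀)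
  lift₂ : ∀ l m, lift (d₂ l) m = l⁻¹ * actML.act l m
  lift₃ : ∀ m l, lift m (d₂ l) = (actML.act l m)⁻¹ * actL.act l (d₁ m)
  lift₄ : ∀ m₀ m₁ m₂, lift m₀ (m₁ * m₂) =
    lift m₀ m₂ * actML.act (lift m₀ m₁) (actM.act m₂ (d₁ m₀))
  lift₅ : ∀ m₀ m₁ m₂, lift (m₀ * m₁) m₂ =
    actML.act (lift m₀ m₂) m₁ * lift m₁ (actM.act m₂ (d₁ m₀))
  lift₆ : ∀ m₀ m₁ p, actL.act (lift m₀ m₁) p = lift (actM.act m₀ p) (actM.act m₁ p)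

end Holonomy

open Holonomy Holonomy.XMod

/-! ### Extensionality, and bijectivity of automorphisms. -/

namespace Holonomy.XMod

section
variable {X : Type u} [Category.{v} X] [IsGroupoid X] {𝒞 : XMod.{w} X}

open Quiver (Costar)

/-! A free derivation `s` is a homotopy from `f = Δ(s)` to the identity, with naturality `f(a) + s₀
= s₀ + a + δ s₁(a)` (`FDer.map_s₀`). The relation `f s' = s f` (`Intertwines f s' s`) respects
products of derivations and composition of the morphisms `f`, and it implies `f Δ(s') = Δ(s) f`. An
automorphism is bijective on vertex groups and on the arrows into a given object, so `s` and `f`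
determine `s'` (`Intertwines.unique`). This `s'` is `s ^ f`, and its action laws and the
equivariance of `ζ` follow by uniqueness, with no computation of `f⁻¹`.

For the Peiffer lifting put `t' = t ^ Δ(s)`. Naturality of `s` along `t'₀ x` shows that `t s` and `s
t'` differ at `x` by `δ s₁(t'₀ x)`, which suggests the lifting `s₁(t'₀ x)⁻¹`. In this form the
axioms reduce to the derivation rule, the product formula, the definition of `f₂` and equivariance;
`peiffer_apply` recovers the stated formula.

On the 2-groupoid side, a 2-cell `η : a ⟶ b` amounts to `a` together with `-a + η`, a 2-cell out of
an identity. Hence an endomorphism of `𝒞` extends in exactly one way to a strict 2-functor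
(`mapTwoGroupoid_bijective`), and the 2-crossed module is transported along `Aut(𝒢) ≃ Aut(𝒞)`. It is
unique because the conditions fix all its data, at worst after applying an injective map.

Endpoints often agree only propositionally, so such equalities are stated in `Σ` types or in
`Costar`, the arrows into an object bundled with their source. -/

theorem Hom.ext_of_sigma {f g : Hom 𝒞 𝒞}
    (h₁ : ∀ {x y : X} (a : x ⟶ y),
      (⟨f.base.obj x, f.base.obj y, f.base.map a⟩ : Σ x y : X, x ⟶ y) =
        ⟨g.base.obj x, g.base.obj y, g.base.map a⟩)
    (h₂ : ∀ (x : X) (c : 𝒞.C x),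
      (⟨f.base.obj x, f.top x c⟩ : Σ x : X, 𝒞.C x) = ⟨g.base.obj x, g.top x c⟩) : f = g := by
  obtain ⟨⟨F, m, i, j⟩, t, p, q⟩ := f
  obtain ⟨⟨G, n, i', j'⟩, t', p', q'⟩ := g
  obtain rfl : F = G := funext fun x => congrArg Sigma.fst (h₁ (𝟙 x))
  obtain rfl : @m = @n := by
    funext x y a
    simpa using h₁ a
  exact Hom.ext_of fun x c => by simpa using h₂ x c

/-- A variable `f` with `f = 1` can be substituted away; this is applied to the products `f⁻¹ * f`
and `f * f⁻¹`. -/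
theorem Hom.top_bijective_of_eq_one {f : Hom 𝒞 𝒞} (h : f = 1) (x : X) :
    Function.Bijective (f.top x) := by
  subst h
  exact Function.bijective_id

theorem Hom.costar_bijective_of_eq_one {f : Hom 𝒞 𝒞} (h : f = 1) (x : X) :
    Function.Bijective
      (fun p : Costar x => (Costar.mk (f.base.map p.2) : Costar (f.base.obj x))) := by
  subst h
  exact Function.bijective_id

theorem Aut.inv_obj_obj (f : Aut 𝒞) (x : X) : f⁻¹.val.base.obj (f.val.base.obj x) = x :=
  congrArg (fun g : Hom 𝒞 𝒞 => g.base.obj x) f.inv_mul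

theorem Aut.top_bijective (f : Aut 𝒞) (x : X) : Function.Bijective (f.val.top x) := by
  refine ⟨Function.Injective.of_comp (Hom.top_bijective_of_eq_one f.inv_mul x).1, ?_⟩
  -- `f f⁻¹ = 1` gives surjectivity of `f₂` only at vertices of the form `f⁻¹ y`; the choice `y = f
  -- x` gives it at `x`.
  have h : Function.Surjective
      (f.val.top (f⁻¹.val.base.obj (f.val.base.obj x)) ∘ f⁻¹.val.top (f.val.base.obj x)) :=
    (Hom.top_bijective_of_eq_one f.mul_inv (f.val.base.obj x)).2
  have h' := h.of_comp
  rwa [f.inv_obj_obj x] at h'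

theorem Aut.costar_bijective (f : Aut 𝒞) (x : X) :
    Function.Bijective
      (fun p : Costar x => (Costar.mk (f.val.base.map p.2) : Costar (f.val.base.obj x))) := by
  constructor
  · have h := (Hom.costar_bijective_of_eq_one f.inv_mul x).1
    exact Function.Injective.of_comp
      (f := fun p : Costar (f.val.base.obj x) =>
        (Costar.mk (f⁻¹.val.base.map p.2) : Costar (f⁻¹.val.base.obj (f.val.base.obj x)))) h
  · have h := (Hom.costar_bijective_of_eq_one f.mul_inv (f.val.base.obj x)).2
    have h' := Function.Surjective.of_comp
      (f := fun p : Costar (f⁻¹.val.base.obj (f.val.base.obj x)) =>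
        (Costar.mk (f.val.base.map p.2) :
          Costar (f.val.base.obj (f⁻¹.val.base.obj (f.val.base.obj x)))))
      (g := fun p : Costar (f.val.base.obj x) => Costar.mk (f⁻¹.val.base.map p.2)) h
    rwa [f.inv_obj_obj x] at h'

/-- The arrow `s₀ x` of a free derivation, with its source. -/
def FDer.star (s : FDer 𝒞) (x : X) : Costar x := Costar.mk (s.s₀ x)

theorem FDer.ext_star {s t : FDer 𝒞} (h₀ : ∀ x, s.star x = t.star x)
    (h₁ : ∀ {x y : X} (a : x ⟶ y), s.s₁ a = t.s₁ a) : s = t := by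
  obtain ⟨src, s₀, s₁, p⟩ := s
  obtain ⟨src', t₀, t₁, q⟩ := t
  obtain rfl : src = src' := funext fun x => congrArg Sigma.fst (h₀ x)
  exact FDer.ext_of (fun x => by simpa [FDer.star, Costar.mk] using h₀ x) h₁

theorem FDer.mul_s₁ (s t : FDer 𝒞) {x y : X} (a : x ⟶ y) :
    (s * t).s₁ a = t.s₁ a * 𝒞.act (s.s₁ (t.map a)) (t.s₀ y) := rfl

theorem Δ_top (s : FDer 𝒞) (x : X) (c : 𝒞.C x) :
    (Δ s).top x c = 𝒞.act (c * s.s₁ (𝒞.δ c)) (inv (s.s₀ x)) := rfl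

theorem act_inv_act {x y : X} (c : 𝒞.C y) (a : x ⟶ y) :
    𝒞.act (𝒞.act c (inv a)) a = c := by
  rw [← 𝒞.act_comp, IsIso.inv_hom_id, 𝒞.act_id]

theorem FDer.map_s₀ (s : FDer 𝒞) {x y : X} (a : x ⟶ y) :
    s.map a ≫ s.s₀ y = s.s₀ x ≫ a ≫ 𝒞.δ (s.s₁ a) := by
  simp [FDer.map]

/-! ### `Δ` and `ζ` as homomorphisms. -/

/-- `Δ : FDer(𝒞) → End(𝒞)` as a homomorphism of monoids. -/
noncomputable def ΔHom : FDer 𝒞 →* Hom 𝒞 𝒞 where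
  toFun := Δ
  map_one' := by
    refine Hom.ext_of_sigma (fun {x y} a => ?_) fun x c => ?_
    · exact congrArg (fun b : x ⟶ y => (⟨x, y, b⟩ : Σ x y : X, x ⟶ y)) (FDer.one_map a)
    · refine congrArg (fun d : 𝒞.C x => (⟨x, d⟩ : Σ x : X, 𝒞.C x)) ?_
      change 𝒞.act (c * 1) (inv (𝟙 x)) = c
      rw [mul_one, IsIso.inv_id, 𝒞.act_id]
  map_mul' s t := by
    refine Hom.ext_of_sigma (fun {x y} a => ?_) fun x c => ?_
    · exact congrArg (fun b : s.src (t.src x) ⟶ s.src (t.src y) =>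
        (⟨_, _, b⟩ : Σ x y : X, x ⟶ y)) (FDer.mul_map s t a)
    · refine congrArg (fun d : 𝒞.C (s.src (t.src x)) => (⟨_, d⟩ : Σ x : X, 𝒞.C x)) ?_
      change 𝒞.act (c * (t.s₁ (𝒞.δ c) * 𝒞.act (s.s₁ (t.map (𝒞.δ c))) (t.s₀ x)))
        (inv (s.s₀ (t.src x) ≫ t.s₀ x)) =
        𝒞.act (𝒞.act (c * t.s₁ (𝒞.δ c)) (inv (t.s₀ x)) *
          s.s₁ (𝒞.δ (𝒞.act (c * t.s₁ (𝒞.δ c)) (inv (t.s₀ x))))) (inv (s.s₀ (t.src x)))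
      have h : 𝒞.δ (𝒞.act (c * t.s₁ (𝒞.δ c)) (inv (t.s₀ x))) = t.map (𝒞.δ c) := (Δ t).δ_top c
      rw [h, IsIso.inv_comp, 𝒞.act_comp, ← mul_assoc, 𝒞.mul_act _ _ (inv (t.s₀ x)),
        ← 𝒞.act_comp _ (t.s₀ x), IsIso.hom_inv_id, 𝒞.act_id]

/-- Since `δ (l x ^ a) = -a + δ (l x) + a`, the terms in `δ (l x)` and `δ (l y)` cancel. -/
theorem ζ_map (l : M₂ 𝒞) {x y : X} (a : x ⟶ y) : (ζ l).map a = a := by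
  have h : 𝒞.δ (l y) ≫ inv (𝒞.δ (l y)) = 𝟙 y := IsIso.hom_inv_id _
  have hx : 𝒞.δ (𝒞.act (l x) a)⁻¹ = inv (𝒞.δ (𝒞.act (l x) a)) := by
    rw [← cancel_mono (𝒞.δ (𝒞.act (l x) a)), ← 𝒞.δ_mul, inv_mul_cancel, δ_one,
      IsIso.inv_hom_id]
  simp [FDer.map, ζ, 𝒞.δ_mul, hx, 𝒞.δ_act]

/-- `ζ : M₂(𝒞) → FDer(𝒞)` as a homomorphism of monoids. -/
noncomputable def ζHom : M₂ 𝒞 →* FDer 𝒞 where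
  toFun := ζ
  map_one' := FDer.ext_of (fun x => δ_one x) fun {x y} a => by
    change (𝒞.act (1 : 𝒞.C x) a)⁻¹ * 1 = 1
    rw [one_act, mul_one, inv_one]
  map_mul' l m := FDer.ext_of (fun x => 𝒞.δ_mul _ _) fun {x y} a => by
    -- The variable `b` stands for `(ζ m).map a`, so that `ζ_map` enters by substitution.
    have h : ∀ b : x ⟶ y, b = a → (𝒞.act (l x * m x) a)⁻¹ * (l y * m y) =
        (𝒞.act (m x) a)⁻¹ * m y * 𝒞.act ((𝒞.act (l x) b)⁻¹ * l y) (𝒞.δ (m y)) := by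
      rintro b rfl
      rw [𝒞.act_δ, 𝒞.mul_act]
      group
    exact h _ (ζ_map m a)

theorem Δ_ζ (l : M₂ 𝒞) : Δ (ζ l) = 1 := by
  refine Hom.ext_of_sigma (fun {x y} a => ?_) fun x c => ?_
  · exact congrArg (fun b : x ⟶ y => (⟨x, y, b⟩ : Σ x y : X, x ⟶ y)) (ζ_map l a)
  · refine congrArg (fun d : 𝒞.C x => (⟨x, d⟩ : Σ x : X, 𝒞.C x)) ?_
    change 𝒞.act (c * ((𝒞.act (l x) (𝒞.δ c))⁻¹ * l x)) (inv (𝒞.δ (l x))) = c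
    have h : c * ((𝒞.act (l x) (𝒞.δ c))⁻¹ * l x) = 𝒞.act c (𝒞.δ (l x)) := by
      rw [𝒞.act_δ, 𝒞.act_δ]
      group
    rw [h, ← 𝒞.act_comp, IsIso.hom_inv_id, 𝒞.act_id]

/-! ### The intertwining relation. -/

/-- `s` and `s'` are intertwined by `f`: `f s' = s f`. -/
structure Intertwines (f : Hom 𝒞 𝒞) (s' s : FDer 𝒞) : Prop where
  s₀ : ∀ x, (Costar.mk (f.base.map (s'.s₀ x)) : Costar (f.base.obj x)) = s.star (f.base.obj x)
  s₁ : ∀ {x y : X} (a : x ⟶ y), f.top y (s'.s₁ a) = s.s₁ (f.base.map a)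

theorem Hom.map_inv (f : Hom 𝒞 𝒞) {x y : X} (a : x ⟶ y) :
    f.base.map (inv a) = inv (f.base.map a) := Functor.map_inv _ _

namespace Intertwines

/-- The arrows `f(s'₀)` are left in place, because they agree with those of `s` only as elements of
`Costar`. -/
theorem map_map {f : Hom 𝒞 𝒞} {s' s : FDer 𝒞} (h : Intertwines f s' s) {x y : X} (a : x ⟶ y) :
    f.base.map (s'.map a) = f.base.map (s'.s₀ x) ≫ f.base.map a ≫
      𝒞.δ (s.s₁ (f.base.map a)) ≫ inv (f.base.map (s'.s₀ y)) := by
  simp only [FDer.map, Functor.map_comp, ← f.δ_top, h.s₁, f.map_inv]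

theorem one (f : Hom 𝒞 𝒞) : Intertwines f 1 1 where
  s₀ x := congrArg Costar.mk (f.base.map_id x)
  s₁ _ := map_one _

theorem mul {f : Hom 𝒞 𝒞} {s' s t' t : FDer 𝒞} (hs : Intertwines f s' s)
    (ht : Intertwines f t' t) : Intertwines f (s' * t') (s * t) where
  s₀ x := by
    have h₁ := congrArg (fun p : Costar (f.base.obj (t'.src x)) =>
      Costar.mk (p.2 ≫ f.base.map (t'.s₀ x))) (hs.s₀ (t'.src x))
    have h₂ := congrArg (fun p : Costar (f.base.obj x) => Costar.mk (s.s₀ p.1 ≫ p.2)) (ht.s₀ x)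
    refine Eq.trans ?_ (h₁.trans h₂)
    exact congrArg Costar.mk (f.base.map_comp _ _)
  s₁ {x y} a := by
    -- Abstracting over `p` and `q` lets the sources vary with the arrows, so that `ht.s₀` can be
    -- rewritten.
    have h : (fun (p : Costar (f.base.obj x)) (q : Costar (f.base.obj y)) =>
        𝒞.act (s.s₁ (p.2 ≫ f.base.map a ≫ 𝒞.δ (t.s₁ (f.base.map a)) ≫ inv q.2)) q.2)
          (Costar.mk (f.base.map (t'.s₀ x))) (Costar.mk (f.base.map (t'.s₀ y))) =
        𝒞.act (s.s₁ (t.map (f.base.map a))) (t.s₀ (f.base.obj y)) := by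
      rw [ht.s₀, ht.s₀]
      rfl
    rw [FDer.mul_s₁, FDer.mul_s₁, map_mul, f.top_act, hs.s₁, ht.s₁, ht.map_map]
    exact congrArg _ h

theorem comp {f g : Hom 𝒞 𝒞} {r s t : FDer 𝒞} (h₁ : Intertwines g r s)
    (h₂ : Intertwines f s t) : Intertwines (f * g) r t where
  s₀ x := (congrArg (fun p : Costar (g.base.obj x) =>
    (Costar.mk (f.base.map p.2) : Costar (f.base.obj (g.base.obj x)))) (h₁.s₀ x)).trans
      (h₂.s₀ (g.base.obj x))
  s₁ a := (congrArg (f.top _) (h₁.s₁ a)).trans (h₂.s₁ _)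

theorem Δ_comm {f : Hom 𝒞 𝒞} {s' s : FDer 𝒞} (h : Intertwines f s' s) :
    f * Δ s' = Δ s * f := by
  refine Hom.ext_of_sigma (fun {x y} a => ?_) fun x c => ?_
  · have h' : (fun (p : Costar (f.base.obj x)) (q : Costar (f.base.obj y)) =>
        (⟨p.1, q.1, p.2 ≫ f.base.map a ≫ 𝒞.δ (s.s₁ (f.base.map a)) ≫ inv q.2⟩ :
          Σ x y : X, x ⟶ y))
          (Costar.mk (f.base.map (s'.s₀ x))) (Costar.mk (f.base.map (s'.s₀ y))) =
        ⟨_, _, s.map (f.base.map a)⟩ := by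
      rw [h.s₀, h.s₀]
      rfl
    refine Eq.trans ?_ h'
    exact congrArg (fun b => (⟨f.base.obj (s'.src x), f.base.obj (s'.src y), b⟩ :
      Σ x y : X, x ⟶ y)) (h.map_map a)
  · have h' := congrArg (fun p : Costar (f.base.obj x) =>
      (⟨p.1, 𝒞.act (f.top x c * s.s₁ (f.base.map (𝒞.δ c))) (inv p.2)⟩ : Σ x : X, 𝒞.C x))
      (h.s₀ x)
    refine Eq.trans (congrArg (fun b => (⟨f.base.obj (s'.src x), b⟩ : Σ x : X, 𝒞.C x)) ?_)
      (h'.trans (congrArg (fun b => (⟨s.src (f.base.obj x), b⟩ : Σ x : X, 𝒞.C x)) ?_))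
    · refine (f.top_act (c * s'.s₁ (𝒞.δ c)) (inv (s'.s₀ x))).trans ?_
      rw [map_mul, h.s₁, f.map_inv]
    · change _ = (Δ s).top _ (f.top x c)
      rw [Δ_top, f.δ_top]
      rfl

theorem unique {f : Aut 𝒞} {s' s'' s : FDer 𝒞} (h : Intertwines f.val s' s)
    (h' : Intertwines f.val s'' s) : s' = s'' :=
  FDer.ext_star (fun x => (f.costar_bijective x).1 ((h.s₀ x).trans (h'.s₀ x).symm))
    fun a => (f.top_bijective _).1 ((h.s₁ a).trans (h'.s₁ a).symm)

end Intertwines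

/-! ### The three actions. -/

/-- The inverse of the isomorphism `f₂ : C x → C (f₀ x)`. -/
noncomputable def Aut.topSymm (f : Aut 𝒞) (x : X) (c : 𝒞.C (f.val.base.obj x)) : 𝒞.C x :=
  Function.surjInv (f.top_bijective x).2 c

theorem Aut.top_topSymm (f : Aut 𝒞) (x : X) (c : 𝒞.C (f.val.base.obj x)) :
    f.val.top x (f.topSymm x c) = c := Function.surjInv_eq _ c

/-- The inverse of the bijection induced by `f₁` on the arrows with a given target. -/
noncomputable def Aut.costarSymm (f : Aut 𝒞) (x : X) (p : Costar (f.val.base.obj x)) :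
    Costar x :=
  Function.surjInv (f.costar_bijective x).2 p

theorem Aut.costar_costarSymm (f : Aut 𝒞) (x : X) (p : Costar (f.val.base.obj x)) :
    Costar.mk (f.val.base.map (f.costarSymm x p).2) = p :=
  Function.surjInv_eq (f.costar_bijective x).2 p

/-- The action `s ^ f = f⁻¹ s f` of an automorphism on a free derivation. -/
noncomputable def FDer.conj (s : FDer 𝒞) (f : Aut 𝒞) : FDer 𝒞 where
  src x := (f.costarSymm x (s.star (f.val.base.obj x))).1
  s₀ x := (f.costarSymm x (s.star (f.val.base.obj x))).2
  s₁ {_ y} a := f.topSymm y (s.s₁ (f.val.base.map a))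
  s₁_comp {x y z} a b := by
    apply (f.top_bijective z).1
    simp only [map_mul, f.val.top_act, f.top_topSymm, Functor.map_comp, s.s₁_comp]

theorem FDer.conj_intertwines (s : FDer 𝒞) (f : Aut 𝒞) : Intertwines f.val (s.conj f) s where
  s₀ x := f.costar_costarSymm x _
  s₁ _ := f.top_topSymm _ _

/-- The action of an automorphism on free derivations, as a homomorphism of monoids. -/
noncomputable def FDer.conjHom (f : Aut 𝒞) : FDer 𝒞 →* FDer 𝒞 where
  toFun s := s.conj f
  map_one' := (FDer.conj_intertwines 1 f).unique (.one _)
  map_mul' s t := ((s * t).conj_intertwines f).unique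
    ((s.conj_intertwines f).mul (t.conj_intertwines f))

theorem FDer.conj_one (s : FDer 𝒞) : s.conj 1 = s :=
  (s.conj_intertwines 1).unique ⟨fun _ => rfl, fun _ => rfl⟩

theorem FDer.conj_mul (s : FDer 𝒞) (f g : Aut 𝒞) : s.conj (f * g) = (s.conj f).conj g :=
  (s.conj_intertwines (f * g)).unique
    (((s.conj f).conj_intertwines g).comp (s.conj_intertwines f))

variable (𝒞) in
/-- The action of `Aut(𝒞)` on `FDer*(𝒞)`. -/
noncomputable def actAutFDer : RightAction (Aut 𝒞) (FDerStar 𝒞) where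
  act s f := Units.map (FDer.conjHom f) s
  act_one s := Units.ext s.val.conj_one
  act_mul s f g := Units.ext (s.val.conj_mul f g)
  mul_act s t _ := map_mul _ s t

variable (𝒞) in
/-- The action of `Aut(𝒞)` on `M₂(𝒞)`. -/
noncomputable def actAutSec : RightAction (Aut 𝒞) (M₂ 𝒞) where
  act l f x := f.topSymm x (l (f.val.base.obj x))
  act_one l := funext fun x => (Aut.top_bijective 1 x).1 (Aut.top_topSymm 1 x _)
  act_mul _ f g := funext fun x => (Aut.top_bijective (f * g) x).1 <| by
    rw [Aut.top_topSymm]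
    change _ = f.val.top _ (g.val.top _ _)
    rw [g.top_topSymm, f.top_topSymm]
    rfl
  mul_act l l' f := funext fun x => (Aut.top_bijective f x).1 <| by
    simp only [Pi.mul_apply, map_mul, f.top_topSymm]

theorem top_actAutSec (l : M₂ 𝒞) (f : Aut 𝒞) (x : X) :
    f.val.top x ((actAutSec 𝒞).act l f x) = l (f.val.base.obj x) := f.top_topSymm x _

variable (𝒞) in
/-- The action of `FDer*(𝒞)` on `M₂(𝒞)`. -/
noncomputable def actFDerSec : RightAction (FDerStar 𝒞) (M₂ 𝒞) where
  act l t x := 𝒞.act (l (t.val.src x)) (t.val.s₀ x)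
  act_one _ := funext fun _ => 𝒞.act_id _
  act_mul _ _ _ := funext fun _ => 𝒞.act_comp _ _ _
  mul_act _ _ _ := funext fun _ => 𝒞.mul_act _ _ _

/-- `ζ` is built from `δ`, the action and the group structure, all of which `f` preserves. -/
theorem ζ_intertwines (l : M₂ 𝒞) (f : Aut 𝒞) :
    Intertwines f.val (ζ ((actAutSec 𝒞).act l f)) (ζ l) where
  s₀ x := by
    refine congrArg Costar.mk (?_ : f.val.base.map (𝒞.δ ((actAutSec 𝒞).act l f x)) =
      𝒞.δ (l (f.val.base.obj x)))
    rw [← f.val.δ_top, top_actAutSec]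
  s₁ {x y} a := by
    change f.val.top y ((𝒞.act ((actAutSec 𝒞).act l f x) a)⁻¹ * (actAutSec 𝒞).act l f y) =
      (𝒞.act (l (f.val.base.obj x)) (f.val.base.map a))⁻¹ * l (f.val.base.obj y)
    rw [map_mul, map_inv, f.val.top_act, top_actAutSec, top_actAutSec]

end
end Holonomy.XMod

/-! ### The axioms of the 2-crossed module over `Aut(𝒞)`. -/

namespace Holonomy.XMod

section
variable {X : Type u} [Category.{v} X] [IsGroupoid X] {𝒞 : XMod.{w} X}

open Quiver (Costar)

variable (𝒞) in
/-- `Δ : FDer*(𝒞) → Aut(𝒞)`. -/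
noncomputable def ΔStar : FDerStar 𝒞 →* Aut 𝒞 := Units.map ΔHom

variable (𝒞) in
/-- `ζ : M₂(𝒞) → FDer*(𝒞)`. -/
noncomputable def ζStar : M₂ 𝒞 →* FDerStar 𝒞 := ζHom.toHomUnits

theorem actAutFDer_intertwines (s : FDerStar 𝒞) (f : Aut 𝒞) :
    Intertwines f.val ((actAutFDer 𝒞).act s f).val s.val := s.val.conj_intertwines f

theorem ΔStar_ζStar (l : M₂ 𝒞) : ΔStar 𝒞 (ζStar 𝒞 l) = 1 := Units.ext (Δ_ζ l)

theorem ζStar_actAutSec (l : M₂ 𝒞) (f : Aut 𝒞) :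
    ζStar 𝒞 ((actAutSec 𝒞).act l f) = (actAutFDer 𝒞).act (ζStar 𝒞 l) f :=
  Units.ext ((ζ_intertwines l f).unique (actAutFDer_intertwines (ζStar 𝒞 l) f))

theorem ΔStar_actAutFDer (s : FDerStar 𝒞) (f : Aut 𝒞) :
    ΔStar 𝒞 ((actAutFDer 𝒞).act s f) = f⁻¹ * ΔStar 𝒞 s * f := by
  rw [mul_assoc, eq_inv_mul_iff_mul_eq]
  exact Units.ext (actAutFDer_intertwines s f).Δ_comm

/-- Acting by `δ c` is conjugation by `c`. The factor `c * s₁ (δ c)` is `f₂ c` acted on by `s₀`,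
where `f = Δ(s)`. -/
theorem FDer.s₁_δ_mul (s : FDer 𝒞) {x y : X} (c : 𝒞.C y) (a : x ⟶ y) :
    c * s.s₁ (a ≫ 𝒞.δ c) = s.s₁ a * (c * s.s₁ (𝒞.δ c)) := by
  rw [s.s₁_comp, 𝒞.act_δ]
  group

theorem ζStar_actFDerSec (l : M₂ 𝒞) (t : FDerStar 𝒞) :
    ζStar 𝒞 ((actFDerSec 𝒞).act l t) = t⁻¹ * ζStar 𝒞 l * t := by
  -- In the form `t * ζ(l ^ t) = ζ(l) * t` no component of `t⁻¹` is needed.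
  rw [mul_assoc, eq_inv_mul_iff_mul_eq]
  refine Units.ext (FDer.ext_star (fun x => congrArg Costar.mk ?_) fun {x y} a => ?_)
  · change t.val.s₀ x ≫ 𝒞.δ (𝒞.act (l (t.val.src x)) (t.val.s₀ x)) =
      𝒞.δ (l (t.val.src x)) ≫ t.val.s₀ x
    rw [𝒞.δ_act, IsIso.hom_inv_id_assoc]
  · have key : ∀ b : x ⟶ y, b = a →
        (𝒞.act (𝒞.act (l (t.val.src x)) (t.val.s₀ x)) a)⁻¹ *
          𝒞.act (l (t.val.src y)) (t.val.s₀ y) *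
          𝒞.act (t.val.s₁ b) (𝒞.δ (𝒞.act (l (t.val.src y)) (t.val.s₀ y))) =
        t.val.s₁ a * 𝒞.act ((𝒞.act (l (t.val.src x)) (t.val.map a))⁻¹ * l (t.val.src y))
          (t.val.s₀ y) := by
      rintro b rfl
      rw [𝒞.mul_act, inv_act, ← 𝒞.act_comp _ (t.val.map b), t.val.map_s₀, 𝒞.act_comp,
        𝒞.act_comp, 𝒞.act_δ, 𝒞.act_δ]
      group
    exact key _ (ζ_map _ a)

theorem actFDerSec_ζStar (l l' : M₂ 𝒞) :
    (actFDerSec 𝒞).act l (ζStar 𝒞 l') = l'⁻¹ * l * l' :=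
  funext fun x => 𝒞.act_δ (l x) (l' x)

theorem actAutSec_actFDerSec (l : M₂ 𝒞) (s : FDerStar 𝒞) (f : Aut 𝒞) :
    (actAutSec 𝒞).act ((actFDerSec 𝒞).act l s) f =
      (actFDerSec 𝒞).act ((actAutSec 𝒞).act l f) ((actAutFDer 𝒞).act s f) := by
  funext x
  apply (f.top_bijective x).1
  rw [top_actAutSec]
  change 𝒞.act (l (s.val.src _)) (s.val.s₀ _) = f.val.top x (𝒞.act _ _)
  rw [f.val.top_act, top_actAutSec]
  exact (congrArg (fun p : Costar (f.val.base.obj x) => 𝒞.act (l p.1) p.2)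
    ((actAutFDer_intertwines s f).s₀ x)).symm

/-- The Peiffer lifting, as a function of `s` and `t' = t ^ Δ(s)`. -/
noncomputable def peiffer (s t : FDerStar 𝒞) : M₂ 𝒞 := fun x =>
  (s.val.s₁ (((actAutFDer 𝒞).act t (ΔStar 𝒞 s)).val.s₀ x))⁻¹

theorem FDer.s₁_mul_act_inv_s₁ (s : FDerStar 𝒞) {x y : X} (a : x ⟶ y) :
    s.val.s₁ a * 𝒞.act (s⁻¹.val.s₁ (s.val.map a)) (s.val.s₀ y) = 1 :=
  congrArg (fun r : FDer 𝒞 => r.s₁ a) s.inv_mul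

/-- The derivation part of `s⁻¹ s = 1`, evaluated at `t'₀ x`, expresses `s₁(t'₀ x)⁻¹` through `s⁻¹`;
then `f(t'₀ x) = t₀(f₀ x)`. -/
theorem peiffer_apply (s t : FDerStar 𝒞) (x : X) :
    peiffer s t x = 𝒞.act (s⁻¹.val.s₁ (t.val.s₀ (s.val.src x))) (s.val.s₀ x) := by
  refine inv_eq_of_mul_eq_one_right (Eq.trans ?_ 
    (FDer.s₁_mul_act_inv_s₁ s (((actAutFDer 𝒞).act t (ΔStar 𝒞 s)).val.s₀ x)))
  exact congrArg (fun p : Costar (s.val.src x) => _ * 𝒞.act (s⁻¹.val.s₁ p.2) (s.val.s₀ x))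
    ((actAutFDer_intertwines t (ΔStar 𝒞 s)).s₀ x).symm

theorem ζStar_peiffer (s t : FDerStar 𝒞) :
    ζStar 𝒞 (peiffer s t) = s⁻¹ * t⁻¹ * s * (actAutFDer 𝒞).act t (ΔStar 𝒞 s) := by
  have hint := actAutFDer_intertwines t (ΔStar 𝒞 s)
  have hp : ∀ x, peiffer s t x =
    (s.val.s₁ (((actAutFDer 𝒞).act t (ΔStar 𝒞 s)).val.s₀ x))⁻¹ := fun _ => rfl
  generalize (actAutFDer 𝒞).act t (ΔStar 𝒞 s) = t' at hint hp ⊢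
  -- The equation becomes `t * s * ζ(⟨s, t⟩) = s * t'`.
  rw [mul_assoc, mul_assoc, eq_inv_mul_iff_mul_eq, eq_inv_mul_iff_mul_eq, ← mul_assoc]
  have hb : ∀ x, (Costar.mk (s.val.map (t'.val.s₀ x)) : Costar (s.val.src x)) =
    t.val.star (s.val.src x) := hint.s₀
  refine Units.ext (FDer.ext_star (fun x => ?_) fun {x y} a => ?_)
  · have h := congrArg (fun p : Costar (s.val.src x) =>
      Costar.mk ((p.2 ≫ s.val.s₀ x) ≫ 𝒞.δ (peiffer s t x))) (hb x)
    refine h.symm.trans (congrArg Costar.mk ?_)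
    change (s.val.map (t'.val.s₀ x) ≫ s.val.s₀ x) ≫ 𝒞.δ (peiffer s t x) =
      s.val.s₀ (t'.val.src x) ≫ t'.val.s₀ x
    rw [FDer.map_s₀, hp, Category.assoc, Category.assoc, ← 𝒞.δ_mul,
      mul_inv_cancel, δ_one, Category.comp_id]
  · have h : 𝒞.act (t'.val.s₁ a * s.val.s₁ (𝒞.δ (t'.val.s₁ a))) (inv (s.val.s₀ y)) =
      t.val.s₁ (s.val.map a) := hint.s₁ a
    have h' : 𝒞.act (t.val.s₁ (s.val.map a)) (s.val.s₀ y) =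
        t'.val.s₁ a * s.val.s₁ (𝒞.δ (t'.val.s₁ a)) := by
      rw [← h, act_inv_act]
    -- Applying `s₁` to the naturality square of `t'` along `a` expresses the value of `s₁` at
    -- `t'.map a` through the other sides.
    have h₂ := congrArg s.val.s₁ (t'.val.map_s₀ a)
    rw [s.val.s₁_comp] at h₂
    have h₃ := s.val.s₁_δ_mul (t'.val.s₁ a) (t'.val.s₀ x ≫ a)
    rw [Category.assoc, s.val.s₁_comp (t'.val.s₀ x) a] at h₃
    have key : ∀ b : x ⟶ y, b = a →
        (𝒞.act (peiffer s t x) a)⁻¹ * peiffer s t y *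
          𝒞.act (s.val.s₁ b * 𝒞.act (t.val.s₁ (s.val.map b)) (s.val.s₀ y))
            (𝒞.δ (peiffer s t y)) =
        t'.val.s₁ a * 𝒞.act (s.val.s₁ (t'.val.map a)) (t'.val.s₀ y) := by
      rintro b rfl
      rw [eq_mul_inv_of_mul_eq h₂, h', 𝒞.act_δ, hp, hp, inv_act, ← mul_assoc (t'.val.s₁ b), h₃]
      group
    have hz : (ζ (peiffer s t)).map a = a := ζ_map (peiffer s t) a
    refine Eq.trans ?_ (key _ hz)
    rfl

theorem peiffer_ζStar_left (l : M₂ 𝒞) (t : FDerStar 𝒞) :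
    peiffer (ζStar 𝒞 l) t = l⁻¹ * (actFDerSec 𝒞).act l t := by
  funext x
  unfold peiffer
  rw [ΔStar_ζStar, (actAutFDer 𝒞).act_one]
  change ((𝒞.act (l (t.val.src x)) (t.val.s₀ x))⁻¹ * l x)⁻¹ =
    (l x)⁻¹ * 𝒞.act (l (t.val.src x)) (t.val.s₀ x)
  group

/-- Here `t' = ζ(l')` with `l' = l ^ f`, and `f₂ l' = l f₀` unfolds to `l' * s₁ (δ l') = (l f₀) ^
s₀`. -/
theorem peiffer_ζStar_right (s : FDerStar 𝒞) (l : M₂ 𝒞) :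
    peiffer s (ζStar 𝒞 l) =
      ((actFDerSec 𝒞).act l s)⁻¹ * (actAutSec 𝒞).act l (ΔStar 𝒞 s) := by
  funext x
  unfold peiffer
  rw [← ζStar_actAutSec]
  have h := top_actAutSec l (ΔStar 𝒞 s) x
  generalize (actAutSec 𝒞).act l (ΔStar 𝒞 s) = l' at h ⊢
  have h' := congrArg (fun c : 𝒞.C (s.val.src x) => 𝒞.act c (s.val.s₀ x)) h
  have h'' : l' x * s.val.s₁ (𝒞.δ (l' x)) = 𝒞.act (l (s.val.src x)) (s.val.s₀ x) :=
    (act_inv_act _ (s.val.s₀ x)).symm.trans h'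
  change (s.val.s₁ (𝒞.δ (l' x)))⁻¹ = (𝒞.act (l (s.val.src x)) (s.val.s₀ x))⁻¹ * l' x
  rw [← h'']
  group

theorem peiffer_mul_right (s t r : FDerStar 𝒞) :
    peiffer s (t * r) = peiffer s r *
      (actFDerSec 𝒞).act (peiffer s t) ((actAutFDer 𝒞).act r (ΔStar 𝒞 s)) := by
  funext x
  unfold peiffer
  rw [(actAutFDer 𝒞).mul_act]
  generalize (actAutFDer 𝒞).act t (ΔStar 𝒞 s) = t'
  generalize (actAutFDer 𝒞).act r (ΔStar 𝒞 s) = r'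
  change (s.val.s₁ (t'.val.s₀ (r'.val.src x) ≫ r'.val.s₀ x))⁻¹ = (s.val.s₁ (r'.val.s₀ x))⁻¹ *
    𝒞.act (s.val.s₁ (t'.val.s₀ (r'.val.src x)))⁻¹ (r'.val.s₀ x)
  rw [s.val.s₁_comp, mul_inv_rev, inv_act]

theorem peiffer_mul_left (s t r : FDerStar 𝒞) :
    peiffer (s * t) r = (actFDerSec 𝒞).act (peiffer s r) t *
      peiffer t ((actAutFDer 𝒞).act r (ΔStar 𝒞 s)) := by
  funext x
  unfold peiffer
  rw [map_mul, (actAutFDer 𝒞).act_mul]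
  generalize (actAutFDer 𝒞).act r (ΔStar 𝒞 s) = r'
  have h := (actAutFDer_intertwines r' (ΔStar 𝒞 t)).s₀ x
  generalize (actAutFDer 𝒞).act r' (ΔStar 𝒞 t) = r'' at h ⊢
  have h' : 𝒞.act (s.val.s₁ (t.val.map (r''.val.s₀ x))) (t.val.s₀ x) =
      𝒞.act (s.val.s₁ (r'.val.s₀ (t.val.src x))) (t.val.s₀ x) :=
    congrArg (fun p : Costar (t.val.src x) => 𝒞.act (s.val.s₁ p.2) (t.val.s₀ x)) h
  change (t.val.s₁ (r''.val.s₀ x) *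
    𝒞.act (s.val.s₁ (t.val.map (r''.val.s₀ x))) (t.val.s₀ x))⁻¹ =
    𝒞.act (s.val.s₁ (r'.val.s₀ (t.val.src x)))⁻¹ (t.val.s₀ x) * (t.val.s₁ (r''.val.s₀ x))⁻¹
  rw [mul_inv_rev, h', inv_act]

/-- Since `Δ(s ^ f) = f⁻¹ Δ(s) f`, the derivation `t'` for the pair `(s ^ f, t ^ f)` is `(t ^ Δ(s))
^ f`. -/
theorem actAutSec_peiffer (s t : FDerStar 𝒞) (f : Aut 𝒞) :
    (actAutSec 𝒞).act (peiffer s t) f =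
      peiffer ((actAutFDer 𝒞).act s f) ((actAutFDer 𝒞).act t f) := by
  funext x
  apply (f.top_bijective x).1
  rw [top_actAutSec]
  unfold peiffer
  rw [ΔStar_actAutFDer, ← (actAutFDer 𝒞).act_mul, mul_assoc, mul_inv_cancel_left,
    (actAutFDer 𝒞).act_mul, map_inv, (actAutFDer_intertwines s f).s₁]
  generalize (actAutFDer 𝒞).act t (ΔStar 𝒞 s) = t'
  exact (congrArg (fun p : Costar (f.val.base.obj x) => (s.val.s₁ p.2)⁻¹)
    ((actAutFDer_intertwines t' f).s₀ x)).symm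

variable (𝒞) in
/-- The 2-crossed module `M₂(𝒞) → FDer*(𝒞) → Aut(𝒞)`. -/
noncomputable def twoCrossedModule : TwoCrossedModule (M₂ 𝒞) (FDerStar 𝒞) (Aut 𝒞) where
  d₂ := ζStar 𝒞
  d₁ := ΔStar 𝒞
  actL := actAutSec 𝒞
  actM := actAutFDer 𝒞
  actML := actFDerSec 𝒞
  d₁_d₂ := ΔStar_ζStar
  d₂_act := ζStar_actAutSec
  d₁_act := ΔStar_actAutFDer
  d₂_actML := ζStar_actFDerSec
  actML_d₂ := actFDerSec_ζStar
  act_compat := actAutSec_actFDerSec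
  lift := peiffer
  lift₁ := ζStar_peiffer
  lift₂ := peiffer_ζStar_left
  lift₃ := peiffer_ζStar_right
  lift₄ := peiffer_mul_right
  lift₅ := peiffer_mul_left
  lift₆ := actAutSec_peiffer

end
end Holonomy.XMod

/-! ### Transport and extensionality of 2-crossed modules. -/

namespace Holonomy

/-- The action obtained by restriction along a homomorphism. -/
def RightAction.comap {P : Type*} {Q : Type*} {L : Type*} [Group P] [Group Q] [Group L]
    (A : RightAction Q L) (e : P →* Q) : RightAction P L where
  act l p := A.act l (e p)
  act_one l := by rw [map_one, A.act_one]
  act_mul l p q := by rw [map_mul, A.act_mul]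
  mul_act l l' p := A.mul_act l l' (e p)

/-- The 2-crossed module obtained by replacing `P` by an isomorphic group. -/
def TwoCrossedModule.congr {L : Type*} {M : Type*} {P : Type*} {Q : Type*} [Group L] [Group M]
    [Group P] [Group Q] (T : TwoCrossedModule L M Q) (e : P ≃* Q) : TwoCrossedModule L M P where
  d₂ := T.d₂
  d₁ := e.symm.toMonoidHom.comp T.d₁
  actL := T.actL.comap e
  actM := T.actM.comap e
  actML := T.actML
  d₁_d₂ l := by simp [T.d₁_d₂]
  d₂_act l p := T.d₂_act l (e p)
  d₁_act m p := by simp [RightAction.comap, T.d₁_act]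
  d₂_actML := T.d₂_actML
  actML_d₂ := T.actML_d₂
  act_compat l m p := T.act_compat l m (e p)
  lift := T.lift
  lift₁ m₀ m₁ := by simp [RightAction.comap, T.lift₁]
  lift₂ := T.lift₂
  lift₃ m l := by simp [RightAction.comap, T.lift₃]
  lift₄ m₀ m₁ m₂ := by simp [RightAction.comap, T.lift₄]
  lift₅ m₀ m₁ m₂ := by simp [RightAction.comap, T.lift₅]
  lift₆ m₀ m₁ p := T.lift₆ m₀ m₁ (e p)

theorem TwoCrossedModule.ext_of {L : Type*} {M : Type*} {P : Type*} [Group L] [Group M]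
    [Group P] {S T : TwoCrossedModule L M P} (h₂ : ∀ l, S.d₂ l = T.d₂ l)
    (h₁ : ∀ m, S.d₁ m = T.d₁ m) (hL : ∀ l p, S.actL.act l p = T.actL.act l p)
    (hM : ∀ m p, S.actM.act m p = T.actM.act m p)
    (hML : ∀ l m, S.actML.act l m = T.actML.act l m)
    (h : ∀ m m', S.lift m m' = T.lift m m') : S = T := by
  obtain ⟨d₂, d₁, ⟨aL, _, _, _⟩, ⟨aM, _, _, _⟩, ⟨aML, _, _, _⟩, _, _, _, _, _, _, k⟩ := S
  obtain ⟨d₂', d₁', ⟨aL', _, _, _⟩, ⟨aM', _, _, _⟩, ⟨aML', _, _, _⟩, _, _, _, _, _, _, k'⟩ := T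
  obtain rfl : d₂ = d₂' := MonoidHom.ext h₂
  obtain rfl : d₁ = d₁' := MonoidHom.ext h₁
  obtain rfl : aL = aL' := funext₂ hL
  obtain rfl : aM = aM' := funext₂ hM
  obtain rfl : aML = aML' := funext₂ hML
  obtain rfl : k = k' := funext₂ h
  rfl

end Holonomy

/-! ### Strict 2-functors as morphisms of crossed modules. -/

namespace Holonomy

open Bicategory

section
variable {B : Type u} [Bicategory.{w, v} B] [Bicategory.Strict B] [IsGroupoid B]
  [IsLocallyGroupoid B]

/-- The 2-cell with source an identity obtained from `η : a ⟶ b` by whiskering with `inv a`. -/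
noncomputable def Loop.ofCell {x y : B} {a b : x ⟶ y} (η : a ⟶ b) : Loop y where
  arr := inv a ≫ b
  cell := eqToHom (IsIso.inv_hom_id a).symm ≫ inv a ◁ η

/-- The 2-cell `a ⟶ a ≫ l.arr` obtained from `l` by whiskering with `a`. -/
def Loop.toCell {x y : B} (a : x ⟶ y) (l : Loop y) : a ⟶ a ≫ l.arr :=
  eqToHom (Category.comp_id a).symm ≫ a ◁ l.cell

namespace Loop

theorem ofCell_comp_eqToHom {x y : B} {a b c : x ⟶ y} (η : a ⟶ b) (h : b = c) :
    ofCell (η ≫ eqToHom h) = ofCell η := by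
  subst h
  simp

/-- With `b` free, this also covers whiskering by `a` followed by `inv a`, in which the inverse is
the outer factor. -/
theorem whiskerLeft_whiskerLeft_of_eq_id {x y z : B} {a : x ⟶ y} {b : y ⟶ x}
    (h : a ≫ b = 𝟙 x) {f g : x ⟶ z} (η : f ⟶ g) :
    a ◁ b ◁ η = eqToHom (by rw [← Category.assoc, h, Category.id_comp]) ≫ η ≫
      eqToHom (by rw [← Category.assoc, h, Category.id_comp]) := by
  obtain rfl : inv a = b := IsIso.inv_eq_of_hom_inv_id h
  exact whiskerLeft_cancel a η

theorem ofCell_toCell {x y : B} (a : x ⟶ y) (l : Loop y) : ofCell (toCell a l) = l := by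
  obtain ⟨c, η⟩ := l
  dsimp only [ofCell, toCell]
  refine mk_eq (by simp) ?_
  simp [whiskerLeft_whiskerLeft_of_eq_id (IsIso.inv_hom_id a)]

theorem toCell_ofCell {x y : B} {a b : x ⟶ y} (η : a ⟶ b) :
    toCell a (ofCell η) ≫ eqToHom (IsIso.hom_inv_id_assoc a b) = η := by
  dsimp only [toCell, ofCell]
  simp [whiskerLeft_cancel, Strict.associator_eqToIso]

/-- This reduces equations between parallel 2-cells to equations in a vertex group. There vertical
composition becomes the product, left whiskering disappears and right whiskering becomes the action.
-/
theorem ofCell_injective {x y : B} {a b : x ⟶ y} {η θ : a ⟶ b} (h : ofCell η = ofCell θ) :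
    η = θ := by
  rw [← toCell_ofCell η, ← toCell_ofCell θ]
  have : ∀ (l m : Loop y) (h : l = m) (hl : a ≫ l.arr = b) (hm : a ≫ m.arr = b),
      toCell a l ≫ eqToHom hl = toCell a m ≫ eqToHom hm := by
    rintro l m rfl _ _
    rfl
  exact this _ _ h _ _

theorem ofCell_eqToHom {x y : B} {a b : x ⟶ y} (h : a = b) : ofCell (eqToHom h) = one y := by
  subst h
  refine mk_eq (by simp) ?_
  simp

theorem ofCell_cell {x : B} (l : Loop x) : ofCell l.cell = l := by
  obtain ⟨c, η⟩ := l
  refine mk_eq (by simp) ?_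
  dsimp only
  rw [congr_whiskerLeft (IsIso.inv_id)]
  simp [Strict.leftUnitor_eqToIso]

theorem ofCell_comp {x y : B} {a b c : x ⟶ y} (η : a ⟶ b) (θ : b ⟶ c) :
    ofCell (η ≫ θ) = mul (ofCell η) (ofCell θ) := by
  dsimp only [ofCell, mul]
  refine mk_eq (by simp) ?_
  simp [whiskerLeft_whiskerLeft_of_eq_id (IsIso.hom_inv_id b), Strict.associator_eqToIso,
    Strict.rightUnitor_eqToIso]

theorem ofCell_whiskerLeft {x y z : B} (c : z ⟶ x) {a b : x ⟶ y} (η : a ⟶ b) :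
    ofCell (c ◁ η) = ofCell η := by
  dsimp only [ofCell]
  refine mk_eq (by simp) ?_
  rw [congr_whiskerLeft (IsIso.inv_comp)]
  simp [Strict.associator_eqToIso, whiskerLeft_whiskerLeft_of_eq_id (IsIso.inv_hom_id c)]

theorem ofCell_whiskerRight {x y z : B} {a b : x ⟶ y} (η : a ⟶ b) (c : y ⟶ z) :
    ofCell (η ▷ c) = (ofCell η).conj c := by
  dsimp only [ofCell, conj]
  refine mk_eq (by simp) ?_
  rw [congr_whiskerLeft (IsIso.inv_comp)]
  simp [Strict.associator_eqToIso]

theorem map_ofCell (F : StrictPseudofunctor B B) {x y : B} {a b : x ⟶ y} (η : a ⟶ b) :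
    (ofCell η).map F = ofCell (F.map₂ η) := by
  have hinv : F.map (inv a) = inv (F.map a) := F.toFunctor.map_inv a
  dsimp only [ofCell, map]
  refine mk_eq (by rw [F.map_comp, hinv]) ?_
  rw [congr_whiskerLeft hinv.symm]
  simp [F.mapComp_eq_eqToIso, PrelaxFunctor.map₂_eqToHom]

end Loop

open Loop XMod

/-- Compatibility with `δ` gives the whiskered 2-cell the right target. By `ofCell_injective` the
witness is unique, so `ofCell_map₂` characterises the chosen one. -/
theorem XMod.Hom.exists_ofCell (h : XMod.Hom (ofTwoGroupoid B) (ofTwoGroupoid B)) {x y : B}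
    {a b : x ⟶ y} (η : a ⟶ b) :
    ∃ θ : h.base.map a ⟶ h.base.map b, ofCell θ = h.top y (ofCell η) := by
  have e : h.base.map a ≫ (h.top y (ofCell η)).arr = h.base.map b := by
    have := h.δ_top (ofCell η)
    refine (congrArg (h.base.map a ≫ ·) this).trans ?_
    rw [← Functor.map_comp]
    exact congrArg _ (IsIso.hom_inv_id_assoc a b)
  exact ⟨toCell _ _ ≫ eqToHom e, (ofCell_comp_eqToHom _ e).trans (ofCell_toCell _ _)⟩

/-- The effect on 2-cells of the strict 2-functor that corresponds to an endomorphism of the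
associated crossed module. -/
noncomputable def XMod.Hom.map₂ (h : XMod.Hom (ofTwoGroupoid B) (ofTwoGroupoid B)) {x y : B}
    {a b : x ⟶ y} (η : a ⟶ b) : h.base.map a ⟶ h.base.map b :=
  (h.exists_ofCell η).choose

theorem XMod.Hom.ofCell_map₂ (h : XMod.Hom (ofTwoGroupoid B) (ofTwoGroupoid B)) {x y : B}
    {a b : x ⟶ y} (η : a ⟶ b) : ofCell (h.map₂ η) = h.top y (ofCell η) :=
  (h.exists_ofCell η).choose_spec

theorem XMod.Hom.map₂_eqToHom (h : XMod.Hom (ofTwoGroupoid B) (ofTwoGroupoid B)) {x y : B}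
    {a b : x ⟶ y} (e : a = b) : h.map₂ (eqToHom e) = eqToHom (congrArg h.base.map e) := by
  apply ofCell_injective
  rw [h.ofCell_map₂, ofCell_eqToHom, ofCell_eqToHom]
  exact map_one (h.top y)

theorem XMod.Hom.map₂_comp (h : XMod.Hom (ofTwoGroupoid B) (ofTwoGroupoid B)) {x y : B}
    {a b c : x ⟶ y} (η : a ⟶ b) (θ : b ⟶ c) : h.map₂ (η ≫ θ) = h.map₂ η ≫ h.map₂ θ := by
  apply ofCell_injective
  rw [h.ofCell_map₂, ofCell_comp, ofCell_comp, h.ofCell_map₂, h.ofCell_map₂]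
  exact map_mul (h.top y) _ _

theorem XMod.Hom.map₂_whiskerLeft (h : XMod.Hom (ofTwoGroupoid B) (ofTwoGroupoid B))
    {x y z : B} (c : z ⟶ x) {a b : x ⟶ y} (η : a ⟶ b) :
    h.map₂ (c ◁ η) = eqToHom (h.base.map_comp c a) ≫ h.base.map c ◁ h.map₂ η ≫
      eqToHom (h.base.map_comp c b).symm := by
  apply ofCell_injective
  rw [h.ofCell_map₂, ofCell_comp, ofCell_comp, ofCell_eqToHom, ofCell_eqToHom, one_mul',
    mul_one', ofCell_whiskerLeft, ofCell_whiskerLeft, h.ofCell_map₂]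

theorem XMod.Hom.map₂_whiskerRight (h : XMod.Hom (ofTwoGroupoid B) (ofTwoGroupoid B))
    {x y z : B} {a b : x ⟶ y} (η : a ⟶ b) (c : y ⟶ z) :
    h.map₂ (η ▷ c) = eqToHom (h.base.map_comp a c) ≫ h.map₂ η ▷ h.base.map c ≫
      eqToHom (h.base.map_comp b c).symm := by
  apply ofCell_injective
  rw [h.ofCell_map₂, ofCell_comp, ofCell_comp, ofCell_eqToHom, ofCell_eqToHom, one_mul',
    mul_one', ofCell_whiskerRight, ofCell_whiskerRight, h.ofCell_map₂]
  exact h.top_act _ _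

/-- The strict 2-functor that corresponds to an endomorphism of the associated crossed module. -/
noncomputable def XMod.Hom.toStrictPseudofunctor
    (h : XMod.Hom (ofTwoGroupoid B) (ofTwoGroupoid B)) : StrictPseudofunctor B B :=
  StrictPseudofunctor.mk''
    { obj := h.base.obj
      map := h.base.map
      map₂ := h.map₂
      map_id := h.base.map_id
      map_comp := h.base.map_comp
      map₂_id := fun a => h.map₂_eqToHom (Eq.refl a)
      map₂_comp := h.map₂_comp
      map₂_whisker_left := fun c _ _ η => h.map₂_whiskerLeft c η
      map₂_whisker_right := fun η c => h.map₂_whiskerRight η c }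

theorem prelaxFunctor_ext {F G : PrelaxFunctor B B} (h : F.toPrefunctor = G.toPrefunctor)
    (h₂ : ∀ {x y : B} {a b : x ⟶ y} (η : a ⟶ b), HEq (F.map₂ η) (G.map₂ η)) : F = G := by
  obtain ⟨⟨F, m⟩, i, j⟩ := F
  obtain ⟨⟨G, n⟩, i', j'⟩ := G
  obtain rfl : F = G := h
  obtain rfl : @m = @n := by
    funext x y a b η
    exact eq_of_heq (h₂ η)
  rfl

theorem XMod.mapTwoGroupoid_bijective : Function.Bijective (mapTwoGroupoid B) := by
  refine Function.bijective_iff_has_inverse.2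
    ⟨Hom.toStrictPseudofunctor, fun F => ?_, fun h => Hom.ext_of fun x c => ?_⟩
  · refine strictPseudofunctor_ext B (prelaxFunctor_ext rfl fun η => heq_of_eq ?_)
    apply ofCell_injective
    exact ((mapTwoGroupoid B F).ofCell_map₂ η).trans (map_ofCell F η)
  -- Every element of a vertex group is `ofCell` of its own 2-cell, where the 2-functor is known.
  · refine (congrArg (Loop.map h.toStrictPseudofunctor) (ofCell_cell c).symm).trans ?_
    refine (map_ofCell h.toStrictPseudofunctor c.cell).trans ((h.ofCell_map₂ c.cell).trans ?_)
    exact congrArg (h.top x) (ofCell_cell c)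

end

section
variable (B : Type u) [Bicategory.{w, v} B] [Bicategory.Strict B] [IsGroupoid B]
  [IsLocallyGroupoid B]

/-- The monoid isomorphism between the strict 2-functors from a 2-groupoid to itself and the
endomorphisms of its associated crossed module. -/
noncomputable def XMod.endTwoGroupoidEquiv :
    StrictPseudofunctor B B ≃* XMod.Hom (ofTwoGroupoid B) (ofTwoGroupoid B) :=
  MulEquiv.ofBijective
    ({ toFun := mapTwoGroupoid B
       map_one' := Hom.ext_of fun _ c => Loop.map_id c
       map_mul' := fun F G => Hom.ext_of fun _ c => Loop.map_comp G F c } :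
      StrictPseudofunctor B B →* XMod.Hom (ofTwoGroupoid B) (ofTwoGroupoid B))
    mapTwoGroupoid_bijective

theorem XMod.autTwoGroupoid_bijective : Function.Bijective (autTwoGroupoid B) :=
  (Units.mapEquiv (endTwoGroupoidEquiv B)).bijective

/-- The isomorphism `Aut(𝒢) ≃ Aut(𝒞)`. -/
noncomputable def XMod.autTwoGroupoidEquiv : TwoAut B ≃* XMod.Aut (ofTwoGroupoid B) :=
  MulEquiv.ofBijective (autTwoGroupoid B) (autTwoGroupoid_bijective B)

end
end Holonomy

theorem mainTheorem9 (B : Type u) [Bicategory.{w, v} B] [Bicategory.Strict B]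
    [IsGroupoid B] [Bicategory.IsLocallyGroupoid B] :
    Function.Bijective (autTwoGroupoid B) ∧
    ∃! T : TwoCrossedModule (M₂ (ofTwoGroupoid B)) (FDerStar (ofTwoGroupoid B)) (TwoAut B),
      -- the two boundary maps are `ζ` and `Δ`
      (∀ l : M₂ (ofTwoGroupoid B), (T.d₂ l).val = ζ l) ∧
      (∀ s : FDerStar (ofTwoGroupoid B), (autTwoGroupoid B (T.d₁ s)).val = Δ s.val) ∧
      -- the action of `FDer*` on `M₂`: `(l ^ t) x = (l (α (t₀ x))) ^ (t₀ x)`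
      (∀ (l : M₂ (ofTwoGroupoid B)) (t : FDerStar (ofTwoGroupoid B)) (x : B),
        T.actML.act l t x = (ofTwoGroupoid B).act (l (t.val.src x)) (t.val.s₀ x)) ∧
      -- the action of `Aut` on `M₂`: `l ^ f = f⁻¹ l f`
      (∀ (l : M₂ (ofTwoGroupoid B)) (f : TwoAut B) (x : B),
        (mapTwoGroupoid B f.val).top x (T.actL.act l f x) = l (f.val.obj x)) ∧
      -- the action of `Aut` on `FDer*`: `s ^ f = (f⁻¹ s₀ f, f⁻¹ s₁ f)`
      (∀ (s : FDerStar (ofTwoGroupoid B)) (f : TwoAut B) (x : B),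
        Quiver.Costar.mk (f.val.map ((T.actM.act s f).val.s₀ x)) =
          Quiver.Costar.mk (s.val.s₀ (f.val.obj x))) ∧
      (∀ (s : FDerStar (ofTwoGroupoid B)) (f : TwoAut B) (x y : B) (a : x ⟶ y),
        (mapTwoGroupoid B f.val).top y ((T.actM.act s f).val.s₁ a) = s.val.s₁ (f.val.map a)) ∧
      -- the Peiffer lifting: `⟨s, t⟩ x = ((s⁻¹)₁ (t₀ (f₀ x))) ^ (s₀ x)`, where `f = Δ(s)`
      (∀ (s t : FDerStar (ofTwoGroupoid B)) (x : B),
        T.lift s t x =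
          (ofTwoGroupoid B).act (s⁻¹.val.s₁ (t.val.s₀ (s.val.src x))) (s.val.s₀ x)) := by
  refine ⟨autTwoGroupoid_bijective B,
    (twoCrossedModule (ofTwoGroupoid B)).congr (autTwoGroupoidEquiv B),
    ⟨fun _ => rfl, fun s => ?_, fun _ _ _ => rfl, fun l f x => ?_, fun s f x => ?_,
      fun s f x y a => ?_, peiffer_apply⟩, ?_⟩
  · exact congrArg Units.val ((autTwoGroupoidEquiv B).apply_symm_apply (ΔStar _ s))
  · exact top_actAutSec l (autTwoGroupoid B f) x
  · exact (actAutFDer_intertwines s (autTwoGroupoid B f)).s₀ x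
  · exact (actAutFDer_intertwines s (autTwoGroupoid B f)).s₁ a
  -- The map `Δ` and the two actions of `Aut(𝒢)` are prescribed only through `autTwoGroupoid`, `f₂`
  -- and `f₁`; injectivity of the first two and `Intertwines.unique` recover them.
  · rintro T ⟨h₂, h₁, hML, hL, hM₀, hM₁, hlift⟩
    refine TwoCrossedModule.ext_of (fun l => Units.ext (h₂ l)) (fun s => ?_) (fun l f => ?_)
      (fun s f => ?_) (fun l t => funext (hML l t))
      fun s t => funext fun x => (hlift s t x).trans (peiffer_apply s t x).symm
    · refine (autTwoGroupoid_bijective B).1 (Units.ext ((h₁ s).trans ?_))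
      exact (congrArg Units.val ((autTwoGroupoidEquiv B).apply_symm_apply (ΔStar _ s))).symm
    · funext x
      refine (Aut.top_bijective (autTwoGroupoid B f) x).1 ((hL l f x).trans ?_)
      exact (top_actAutSec l (autTwoGroupoid B f) x).symm
    · refine Units.ext (Intertwines.unique (f := autTwoGroupoid B f) ⟨hM₀ s f, hM₁ s f _ _⟩ ?_)
      exact actAutFDer_intertwines s (autTwoGroupoid B f)
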